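/- \textbf{Theorem (Frobenius groups).} Let $G$ be a Frobenius group with Frobenius complement $H$; that is, $G$ is a finite group, $H$ is a non-trivial proper subgroup, and $H\cap H^g=1$ for all $g\in G\setminus H$, where $H^g=g^{-1}Hg$. Let $N$ be its Frobenius kernel (the normal subgroup consisting of the identity and the elements lying in no conjugate of $H$), and suppose that $N$ is abelian. For $h\in H$ let $L_h$ be the square with rows, columns and letters indexed by $N$ and entries $L_h(x,y)=x\,y^h$, where $y^h=h^{-1}yh$. Then the $L_h$ ($h\in H$) are $|H|$ distinct mutually orthogonal Latin squares of order $|N|$. Moreover, consider the following partitions of the set $N\times N$ of cells: the partition into rows, the partition into columns, and, for each $h\in H$, the partition of the cells according to their letter in $L_h$. These $|H|+2$ partitions are pairwise distinct, so there are $\binom{|H|+2}{3}$ triples of them. For any three distinct partitions $P,Q,T$ among them, each part of $P$ meets each part of $Q$ in exactly one cell, and the square whose rows, columns and letters are the parts of $P$, $Q$ and $T$, and whose entry in row $p$ and column $q$ is the part of $T$ containing the unique cell of $p\cap q$, is a Latin square of order $|N|$ that is isotopic to the Cayley table of $N$. (Two squares are isotopic if bijections between their rows, columns and letters transform one into the other.)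 In particular, $\{L_h : h\in H\}$ is a set of mutually orthogonal group squares, i.e. mutually orthogonal Latin squares for which every triple of distinct partitions defines a Latin square isotopic to the Cayley table of a group. -/

import Mathlib

universe u

/-! ### Frobenius groups -/

/-- The conjugate `H^g = g⁻¹ H g`. -/
def conjSubgroup {G : Type*} [Group G] (H : Subgroup G) (g : G) : Subgroup G :=
  H.map (MulAut.conj g⁻¹).toMonoidHom

/-- A finite group `G` is a Frobenius group with Frobenius complement `H`: the subgroup `H` is
non-trivial and proper, and `H ∩ H^g = 1` for all `g ∈ G \ H`. -/
structure IsFrobeniusComplement {G : Type*} [Group G] [Finite G] (H : Subgroup G) : Prop where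
  ne_bot : H ≠ ⊥
  ne_top : H ≠ ⊤
  inf_conj : ∀ g : G, g ∉ H → H ⊓ conjSubgroup H g = ⊥

/-- The identity together with the elements lying in no conjugate of `H`. -/
def frobeniusKernelSet {G : Type*} [Group G] (H : Subgroup G) : Set G :=
  {x | x = 1 ∨ ∀ g : G, x ∉ conjSubgroup H g}

/-- The Frobenius kernel: the subgroup made up of the identity and the elements lying in no
conjugate of `H`. That this set is a subgroup is a theorem of Frobenius; generating a subgroup by
the set makes the definition independent of that theorem. When the kernel is abelian, the equality
of the two is the lemma `coe_frobeniusKernel` below. -/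
def frobeniusKernel {G : Type*} [Group G] (H : Subgroup G) : Subgroup G :=
  Subgroup.closure (frobeniusKernelSet H)

theorem mem_conjSubgroup {G : Type*} [Group G] {H : Subgroup G} {g x : G} :
    x ∈ conjSubgroup H g ↔ g * x * g⁻¹ ∈ H := by
  unfold conjSubgroup
  rw [Subgroup.mem_map]
  constructor
  · rintro ⟨y, hy, rfl⟩
    simpa [mul_assoc] using hy
  · intro h
    exact ⟨_, h, by simp [mul_assoc]⟩

theorem conj_mem_frobeniusKernelSet {G : Type*} [Group G] {H : Subgroup G} (g : G) {x : G}
    (hx : x ∈ frobeniusKernelSet H) : g * x * g⁻¹ ∈ frobeniusKernelSet H := by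
  rcases hx with rfl | hx
  · left; simp
  · right
    intro k hk
    apply hx (k * g)
    rw [mem_conjSubgroup] at hk ⊢
    simpa [mul_assoc] using hk

instance frobeniusKernel_normal {G : Type*} [Group G] (H : Subgroup G) :
    (frobeniusKernel H).Normal where
  conj_mem x hx g := by
    unfold frobeniusKernel at hx ⊢
    induction hx using Subgroup.closure_induction with
    | mem x hx => exact Subgroup.subset_closure (conj_mem_frobeniusKernelSet g hx)
    | one => simp
    | mul x y _ _ h₁ h₂ => simpa [mul_assoc] using mul_mem h₁ h₂
    | inv x _ h => simpa [mul_assoc] using inv_mem h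

/-- If it is abelian, the Frobenius kernel consists of exactly the identity and the elements lying
in no conjugate of `H`. -/
theorem coe_frobeniusKernel {G : Type*} [Group G] [Finite G] {H : Subgroup G}
    (hH : IsFrobeniusComplement H) (hab : ∀ x y : frobeniusKernel H, x * y = y * x) :
    (frobeniusKernel H : Set G) = frobeniusKernelSet H := by
  refine Set.Subset.antisymm ?_ Subgroup.subset_closure
  intro x hx
  by_contra hxK
  have hx' : ¬ (x = 1 ∨ ∀ g : G, x ∉ conjSubgroup H g) := hxK
  push Not at hx'
  obtain ⟨hx1, g, hg⟩ := hx'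
  rw [mem_conjSubgroup] at hg
  have hyN : g * x * g⁻¹ ∈ frobeniusKernel H := (frobeniusKernel_normal H).conj_mem x hx g
  have hy1 : g * x * g⁻¹ ≠ 1 := fun h => hx1 (conj_eq_one_iff.mp h)
  generalize g * x * g⁻¹ = y at hg hyN hy1
  have key : frobeniusKernelSet H ⊆ ({1} : Set G) := by
    rintro k (rfl | hk)
    · rfl
    · exfalso
      have hkN : k ∈ frobeniusKernel H := Subgroup.subset_closure (Or.inr hk)
      have hkH : k ∉ H := fun h => hk 1 (by rw [mem_conjSubgroup]; simpa using h)
      have hc : k * y = y * k := congrArg Subtype.val (hab ⟨k, hkN⟩ ⟨y, hyN⟩)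
      have hmem : y ∈ H ⊓ conjSubgroup H k := by
        refine ⟨hg, mem_conjSubgroup.mpr ?_⟩
        rw [hc]; simpa using hg
      rw [hH.inf_conj k hkH] at hmem
      exact hy1 (Subgroup.mem_bot.mp hmem)
  have hle : frobeniusKernel H ≤ ⊥ := by
    unfold frobeniusKernel
    rw [Subgroup.closure_le]
    exact key
  exact hy1 (Subgroup.mem_bot.mp (hle hyN))

/-! ### Latin squares -/

/-- A Latin square of order `n`: an `n × n` array with `n` letters, in which every letter occurs
exactly once in each row and exactly once in each column. -/
structure IsLatinSquare {R C S : Type*} [Finite R] [Finite C] [Finite S] (n : ℕ)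
    (L : R → C → S) : Prop where
  card_rows : Nat.card R = n
  card_cols : Nat.card C = n
  card_letters : Nat.card S = n
  row_bijective : ∀ x : R, Function.Bijective (fun y : C => L x y)
  col_bijective : ∀ y : C, Function.Bijective (fun x : R => L x y)

/-- Two squares with the same rows and columns are orthogonal: each ordered pair of letters occurs
in exactly one cell. -/
def AreOrthogonal {R C S S' : Type*} (L : R → C → S) (M : R → C → S') : Prop :=
  Function.Bijective (fun p : R × C => (L p.1 p.2, M p.1 p.2))

/-- Mutually orthogonal Latin squares of order `n`. -/
structure IsMOLS {I R C S : Type*} [Finite R] [Finite C] [Finite S] (n : ℕ)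
    (L : I → R → C → S) : Prop where
  latin : ∀ i, IsLatinSquare n (L i)
  orthogonal : ∀ i j, i ≠ j → AreOrthogonal (L i) (L j)

/-- Isotopic squares: permuting (relabelling) rows, columns and letters turns one into
the other. -/
def Isotopic {R C S R' C' S' : Type*} (L : R → C → S) (M : R' → C' → S') : Prop :=
  ∃ (φ : R ≃ R') (χ : C ≃ C') (ψ : S ≃ S'), ∀ x y, M (φ x) (χ y) = ψ (L x y)

/-- The Cayley table of a group. -/
def cayleyTable (K : Type*) [Group K] : K → K → K := fun x y => x * y

/-! ### The partitions of the set of cells, and the squares they define -/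

/-- Labels for the partitions given by a family of squares indexed by `I`. -/
inductive PartLabel (I : Type*) where
  | row : PartLabel I
  | col : PartLabel I
  | letter (i : I) : PartLabel I

/-- The partitions of the set of cells `R × C` into rows, into columns, and according to the
letters of each square. -/
def cellPartition {I R C S : Type*} (L : I → R → C → S) : PartLabel I → Setoid (R × C)
  | .row => Setoid.ker (fun p => p.1)
  | .col => Setoid.ker (fun p => p.2)
  | .letter i => Setoid.ker (fun p => L i p.1 p.2)

/-- Two partitions of `Ω` give it the structure of a grid: each part of `P` meets each part
of `Q` in exactly one point. -/
def IsGrid {Ω : Type*} (P Q : Setoid Ω) : Prop :=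
  Function.Bijective (fun ω : Ω => ((Quotient.mk P ω, Quotient.mk Q ω) : Quotient P × Quotient Q))

/-- The square defined by a triple of partitions, the first two of which form a grid: its rows,
columns and letters are the parts of `P`, `Q` and `T`, and the entry in row `p` and column `q` is
the part of `T` containing the unique point of `p ∩ q`. -/
noncomputable def tripleSquare {Ω : Type*} (P Q T : Setoid Ω) (h : IsGrid P Q) :
    Quotient P → Quotient Q → Quotient T :=
  fun p q => Quotient.mk T ((Equiv.ofBijective _ h).symm (p, q))

/-- Mutually orthogonal group squares of order `n`: mutually orthogonal Latin squares such that all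
the squares defined by triples of distinct partitions are Latin squares isotopic to Cayley tables
of groups. -/
structure IsMOGS {I : Type*} {R C S : Type u} [Finite R] [Finite C] [Finite S] (n : ℕ)
    (L : I → R → C → S) : Prop where
  mols : IsMOLS n L
  group : ∀ a b c : PartLabel I, a ≠ b → a ≠ c → b ≠ c →
    ∃ h : IsGrid (cellPartition L a) (cellPartition L b),
      IsLatinSquare n (tripleSquare _ _ (cellPartition L c) h) ∧
      ∃ (K : Type u) (_ : Group K),
        Isotopic (tripleSquare _ _ (cellPartition L c) h) (cayleyTable K)

/-- The square `L_h(x, y) = x y^h` on the Frobenius kernel, where `y^h = h⁻¹ y h`, for `h ∈ H`. -/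
def frobeniusSquare {G : Type*} [Group G] (H : Subgroup G) (h : H)
    (x y : frobeniusKernel H) : frobeniusKernel H :=
  x * MulAut.conjNormal (h : G)⁻¹ y

/-! ### Squares from pairs of homomorphisms -/

/-! As `N` is abelian, each of the partitions is the partition into fibres of a homomorphism `N × N
→* N`: a projection, or `(x, y) ↦ x * y^h`. Two of these with distinct labels have kernels meeting
trivially. Only the case of two letters `h ≠ k` is not formal: it reduces to `y^h = y^k`, so `h *
k⁻¹ ≠ 1` commutes with `y`, and the Frobenius condition forces `y = 1`. By finiteness the two maps
jointly form a bijection of `N × N` (`bijective_labelHom_prod`), which gives the grids and the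
orthogonality.

A third homomorphism, written in the coordinates given by the first two, is `(u, v) ↦ α u * β v`
with `α`, `β` automorphisms of `N`, so its square is a relabelled Cayley table
(`isotopic_tripleSquare_ker`). Distinctness of the partitions needs `N ≠ 1`, a counting argument. -/

theorem IsLatinSquare.of_isotopic_cayleyTable {R C S K : Type*} [Finite R] [Finite C] [Finite S]
    [Group K] {L : R → C → S} (h : Isotopic L (cayleyTable K)) :
    IsLatinSquare (Nat.card K) L := by
  obtain ⟨φ, χ, ψ, e⟩ := h
  have e' : ∀ x y, L x y = ψ.symm (φ x * χ y) := fun x y => by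
    rw [Equiv.eq_symm_apply, ← e]; rfl
  refine ⟨Nat.card_congr φ, Nat.card_congr χ, Nat.card_congr ψ, fun x => ?_, fun y => ?_⟩
  · simp only [e']
    exact ψ.symm.bijective.comp ((Group.mulLeft_bijective _).comp χ.bijective)
  · simp only [e']
    exact ψ.symm.bijective.comp ((Group.mulRight_bijective (χ y)).comp φ.bijective)

section Homs

variable {A N : Type*} [Group A] [Group N]

theorem surjective_of_prod_bijective_left {f g : A →* N} (h : Function.Bijective (f.prod g)) :
    Function.Surjective f := fun n => by
  obtain ⟨x, hx⟩ := h.2 (n, 1)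
  exact ⟨x, congrArg Prod.fst hx⟩

theorem surjective_of_prod_bijective_right {f g : A →* N} (h : Function.Bijective (f.prod g)) :
    Function.Surjective g := fun n => by
  obtain ⟨x, hx⟩ := h.2 (1, n)
  exact ⟨x, congrArg Prod.snd hx⟩

/-- The fibres of `f` and `g` are labelled by `N`; under this labelling the grid map becomes `f.prod
g`. -/
theorem isGrid_ker {f g : A →* N} (h : Function.Bijective (f.prod g)) :
    IsGrid (Setoid.ker f) (Setoid.ker g) := by
  have hf := surjective_of_prod_bijective_left h
  have hg := surjective_of_prod_bijective_right h
  refine (Function.Bijective.of_comp_iff' ((Setoid.quotientKerEquivOfSurjective f hf).prodCongr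
    (Setoid.quotientKerEquivOfSurjective g hg)).bijective _).mp ?_
  exact h

/-- In the coordinates `(f, g)`, restricting `k` to the two factors gives `α` and `β`. The first is
injective because `g` and `k` have no common kernel, the second because `f` and `k` have none. -/
theorem isotopic_tripleSquare_ker [Finite N] {f g k : A →* N}
    (hfg : Function.Bijective (f.prod g)) (hfk : Function.Injective (f.prod k))
    (hgk : Function.Bijective (g.prod k)) (h : IsGrid (Setoid.ker f) (Setoid.ker g)) :
    Isotopic (tripleSquare (Setoid.ker f) (Setoid.ker g) (Setoid.ker k) h) (cayleyTable N) := by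
  let e : A ≃* N × N := MulEquiv.ofBijective (f.prod g) hfg
  have he : ∀ x, e.symm (f x, g x) = x := fun x => e.symm_apply_apply x
  have hfe : ∀ z, f (e.symm z) = z.1 := fun z => congrArg Prod.fst (e.apply_symm_apply z)
  have hge : ∀ z, g (e.symm z) = z.2 := fun z => congrArg Prod.snd (e.apply_symm_apply z)
  let α : N →* N := k.comp (e.symm.toMonoidHom.comp (MonoidHom.inl N N))
  let β : N →* N := k.comp (e.symm.toMonoidHom.comp (MonoidHom.inr N N))
  have hα : Function.Bijective α := by
    rw [← Finite.injective_iff_bijective, injective_iff_map_eq_one]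
    intro n hn
    have : e.symm (n, 1) = 1 := (injective_iff_map_eq_one _).mp hgk.1 _
      (Prod.ext (hge _) hn)
    simpa [this] using (hfe (n, 1)).symm
  have hβ : Function.Bijective β := by
    rw [← Finite.injective_iff_bijective, injective_iff_map_eq_one]
    intro n hn
    have : e.symm (1, n) = 1 := (injective_iff_map_eq_one _).mp hfk _
      (Prod.ext (hfe _) hn)
    simpa [this] using (hge (1, n)).symm
  refine ⟨(Setoid.quotientKerEquivOfSurjective f (surjective_of_prod_bijective_left hfg)).trans
      (Equiv.ofBijective α hα),
    (Setoid.quotientKerEquivOfSurjective g (surjective_of_prod_bijective_right hfg)).trans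
      (Equiv.ofBijective β hβ),
    Setoid.quotientKerEquivOfSurjective k (surjective_of_prod_bijective_right hgk), fun p q => ?_⟩
  obtain ⟨ω, hω⟩ := h.2 (p, q)
  obtain ⟨rfl, rfl⟩ := Prod.ext_iff.mp hω
  have hs : (Equiv.ofBijective _ h).symm
      (Quotient.mk (Setoid.ker f) ω, Quotient.mk (Setoid.ker g) ω) = ω :=
    (Equiv.ofBijective _ h).symm_apply_apply ω
  unfold tripleSquare
  rw [hs]
  change k (e.symm (f ω, 1)) * k (e.symm (1, g ω)) = k ω
  -- The cell with coordinates `(u, v)` is the product of those with coordinates `(u, 1)` and `(1,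
  -- v)`.
  rw [← map_mul, ← map_mul, Prod.mk_mul_mk, mul_one, one_mul, he]

end Homs

/-! ### Labels and counting -/

/-- The labels are the indices of the squares together with two further elements. -/
def partLabelEquiv (I : Type*) : PartLabel I ≃ Option (Option I) where
  toFun
    | .row => none
    | .col => some none
    | .letter i => some (some i)
  invFun
    | none => .row
    | some none => .col
    | some (some i) => .letter i
  left_inv := by rintro (_ | _ | _) <;> rfl
  right_inv := by rintro (_ | _ | _) <;> rfl

theorem card_partLabel (I : Type*) [Finite I] : Nat.card (PartLabel I) = Nat.card I + 2 := by
  rw [Nat.card_congr (partLabelEquiv I), Finite.card_option, Finite.card_option]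

theorem Set.Finite.ncard_subsets_ncard_eq {α : Type*} {S : Set α} (hS : S.Finite) (n : ℕ) :
    {T : Set α | T ⊆ S ∧ T.ncard = n}.ncard = S.ncard.choose n := by
  have : {T : Set α | T ⊆ S ∧ T.ncard = n} =
      (fun F : Finset α => (F : Set α)) '' (hS.toFinset.powersetCard n : Set (Finset α)) := by
    ext T
    constructor
    · rintro ⟨h1, h2⟩
      have hT : T.Finite := hS.subset h1
      refine ⟨hT.toFinset, ?_, by simp⟩
      rw [Finset.mem_coe, Finset.mem_powersetCard, ← Set.ncard_eq_toFinset_card _ hT]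
      exact ⟨by simpa using h1, h2⟩
    · rintro ⟨F, hF, rfl⟩
      rw [Finset.mem_coe, Finset.mem_powersetCard] at hF
      refine ⟨fun x hx => by simpa using hF.1 hx, ?_⟩
      rw [Set.ncard_coe_finset, hF.2]
  rw [this, Set.ncard_image_of_injective _ Finset.coe_injective, Set.ncard_coe_finset,
    Finset.card_powersetCard, ← Set.ncard_eq_toFinset_card _ hS]

/-! ### The Frobenius kernel -/

/-- The homomorphism whose fibres are the parts of the partition with a given label. -/
def labelHom {G : Type*} [Group G] {H : Subgroup G}
    (hab : ∀ x y : frobeniusKernel H, x * y = y * x) :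
    PartLabel H → frobeniusKernel H × frobeniusKernel H →* frobeniusKernel H
  | .row => MonoidHom.fst _ _
  | .col => MonoidHom.snd _ _
  | .letter h => MonoidHom.mk' (fun p => frobeniusSquare H h p.1 p.2) fun p q => by
      simp only [frobeniusSquare, Prod.fst_mul, Prod.snd_mul, map_mul]
      -- Commutativity of the kernel enters here, to move `q.1` past the conjugate of `p.2`.
      rw [mul_assoc, mul_assoc, ← mul_assoc q.1, hab q.1, mul_assoc]

theorem cellPartition_frobeniusSquare {G : Type*} [Group G] {H : Subgroup G}
    (hab : ∀ x y : frobeniusKernel H, x * y = y * x) (a : PartLabel H) :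
    cellPartition (frobeniusSquare H) a = Setoid.ker (labelHom hab a) := by
  cases a <;> rfl

section Frobenius

variable {G : Type*} [Group G] [Finite G] {H : Subgroup G}

/-- The Frobenius kernel is non-trivial: by counting, the conjugates of a Frobenius complement do
not cover the group. -/
theorem frobeniusKernel_ne_bot (hH : IsFrobeniusComplement H) : frobeniusKernel H ≠ ⊥ := by
  classical
  intro hbot
  have hcover : ∀ x : G, x ≠ 1 → ∃ g : G, x ∈ conjSubgroup H g := by
    intro x hx
    by_contra! hc
    have : x ∈ frobeniusKernel H := Subgroup.subset_closure (Or.inr hc)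
    rw [hbot] at this
    exact hx (Subgroup.mem_bot.mp this)
  -- One representative per coset suffices, since all elements of a coset `gH` conjugate `H` to the
  -- same subgroup.
  let F : (G ⧸ H) × {h : H // h ≠ 1} → {x : G // x ≠ 1} := fun p =>
    ⟨p.1.out * (p.2.1 : G) * p.1.out⁻¹, fun h => p.2.2 (by
      ext; simpa using conj_eq_one_iff.mp h)⟩
  have hF : Function.Surjective F := by
    rintro ⟨x, hx⟩
    obtain ⟨g, hg⟩ := hcover x hx
    rw [mem_conjSubgroup] at hg
    obtain ⟨h', hh'⟩ := QuotientGroup.mk_out_eq_mul H g⁻¹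
    have hy : ((h' : G)⁻¹ * (g * x * g⁻¹) * h') ∈ H :=
      H.mul_mem (H.mul_mem (H.inv_mem h'.2) hg) h'.2
    refine ⟨((g⁻¹ : G), ⟨⟨_, hy⟩, fun h => hx ?_⟩), ?_⟩
    · have h1 : (h' : G)⁻¹ * (g * x * g⁻¹) * h' = 1 := congrArg Subtype.val h
      have h2 : ((h' : G)⁻¹ * g) * x * ((h' : G)⁻¹ * g)⁻¹ = 1 := by
        rw [← h1]; group
      exact conj_eq_one_iff.mp h2
    · apply Subtype.ext
      change Quotient.out _ * ((h' : G)⁻¹ * (g * x * g⁻¹) * h') * (Quotient.out _)⁻¹ = x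
      rw [hh']
      group
  have hcard := Nat.card_le_card_of_surjective F hF
  have hne : ∀ (K : Type _) [Group K] [Finite K],
      Nat.card {x : K // x ≠ 1} + 1 = Nat.card K := by
    intro K _ _
    rw [← Finite.card_option, Nat.card_congr (Equiv.optionSubtypeNe (1 : K))]
  have h1 := hne G
  have h2 := hne H
  rw [Nat.card_prod] at hcard
  have h3 := H.card_mul_index
  rw [Subgroup.index] at h3
  have h4 : Nat.card (G ⧸ H) ≠ 1 := fun h => hH.ne_top (Subgroup.index_eq_one.mp h)
  have h5 : 0 < Nat.card (G ⧸ H) := Nat.card_pos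
  -- Surjectivity of `F` gives `|G| - 1 ≤ |G : H| (|H| - 1) = |G| - |G : H|`, so the index would be
  -- 1.
  rw [← h1, ← h2, add_mul, one_mul, mul_comm] at h3
  omega

/-- Non-identity elements of a Frobenius complement centralise no non-identity element of the
Frobenius kernel. -/
theorem eq_one_of_commute_complement (hH : IsFrobeniusComplement H)
    (hab : ∀ x y : frobeniusKernel H, x * y = y * x) {h n : G} (hh : h ∈ H) (h1 : h ≠ 1)
    (hn : n ∈ frobeniusKernel H) (hc : n * h = h * n) : n = 1 := by
  have hnH : n ∈ H := by
    by_contra hnH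
    have hmem : h ∈ H ⊓ conjSubgroup H n :=
      ⟨hh, mem_conjSubgroup.mpr (by rw [hc]; simpa using hh)⟩
    rw [hH.inf_conj n hnH] at hmem
    exact h1 (Subgroup.mem_bot.mp hmem)
  have hn' : n ∈ frobeniusKernelSet H := by
    rw [← coe_frobeniusKernel hH hab]; exact hn
  rcases hn' with h | h
  · exact h
  · exact absurd (mem_conjSubgroup.mpr (by simpa using hnH)) (h 1)

theorem eq_one_of_conjNormal_eq (hH : IsFrobeniusComplement H)
    (hab : ∀ x y : frobeniusKernel H, x * y = y * x) {h k : H} (hhk : h ≠ k)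
    {y : frobeniusKernel H}
    (e : MulAut.conjNormal (h : G)⁻¹ y = MulAut.conjNormal (k : G)⁻¹ y) : y = 1 := by
  have e' : (h : G)⁻¹ * y * h = (k : G)⁻¹ * y * k := by
    simpa using congrArg Subtype.val e
  refine Subtype.ext (eq_one_of_commute_complement hH hab
    (h := (h : G) * (k : G)⁻¹) (H.mul_mem h.2 (H.inv_mem k.2)) ?_ y.2 ?_)
  · exact fun hk => hhk (Subtype.ext (mul_inv_eq_one.mp hk))
  · calc (y : G) * (h * (k : G)⁻¹) = h * ((h : G)⁻¹ * y * h) * (k : G)⁻¹ := by group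
      _ = h * (k : G)⁻¹ * y := by rw [e']; group

theorem eq_one_of_labelHom_eq_one (hH : IsFrobeniusComplement H)
    (hab : ∀ x y : frobeniusKernel H, x * y = y * x) {a b : PartLabel H} (h : a ≠ b)
    {p : frobeniusKernel H × frobeniusKernel H}
    (ha : labelHom hab a p = 1) (hb : labelHom hab b p = 1) : p = 1 := by
  obtain ⟨x, y⟩ := p
  have row_letter : ∀ h : H, x = 1 → x * MulAut.conjNormal (h : G)⁻¹ y = 1 → (x, y) = 1 := by
    rintro h rfl e
    rw [one_mul, EmbeddingLike.map_eq_one_iff] at e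
    rw [e]; rfl
  have col_letter : ∀ h : H, y = 1 → x * MulAut.conjNormal (h : G)⁻¹ y = 1 → (x, y) = 1 := by
    rintro h rfl e
    rw [map_one, mul_one] at e
    rw [e]; rfl
  rcases a with _ | _ | i <;> rcases b with _ | _ | j
  · exact absurd rfl h
  · exact Prod.ext ha hb
  · exact row_letter j ha hb
  · exact Prod.ext hb ha
  · exact absurd rfl h
  · exact col_letter j ha hb
  · exact row_letter i hb ha
  · exact col_letter i hb ha
  · have hij : i ≠ j := fun e => h (by rw [e])
    -- Cancelling `x` in `x * y^i = x * y^j` yields `y^i = y^j`, hence `y = 1`.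
    exact col_letter i (eq_one_of_conjNormal_eq hH hab hij
      (mul_left_cancel (ha.trans hb.symm))) ha

theorem bijective_labelHom_prod (hH : IsFrobeniusComplement H)
    (hab : ∀ x y : frobeniusKernel H, x * y = y * x) {a b : PartLabel H} (h : a ≠ b) :
    Function.Bijective ((labelHom hab a).prod (labelHom hab b)) := by
  rw [← Finite.injective_iff_bijective, injective_iff_map_eq_one]
  intro p hp
  exact eq_one_of_labelHom_eq_one hH hab h (congrArg Prod.fst hp) (congrArg Prod.snd hp)

/-- For distinct labels some `p` is sent to `1` by one homomorphism and to an arbitrary `n` by the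
other; equal fibres would force `n = 1`, making the kernel trivial. -/
theorem cellPartition_frobeniusSquare_injective (hH : IsFrobeniusComplement H)
    (hab : ∀ x y : frobeniusKernel H, x * y = y * x) :
    Function.Injective (cellPartition (frobeniusSquare H)) := by
  intro a b e
  by_contra hne
  rw [cellPartition_frobeniusSquare hab, cellPartition_frobeniusSquare hab] at e
  refine frobeniusKernel_ne_bot hH ((Subgroup.eq_bot_iff_forall _).mpr fun n hn => ?_)
  obtain ⟨p, hp⟩ := (bijective_labelHom_prod hH hab hne).2 (1, ⟨n, hn⟩)
  have ha : labelHom hab a p = 1 := congrArg Prod.fst hp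
  have hb : labelHom hab b p = ⟨n, hn⟩ := congrArg Prod.snd hp
  have h1 : Setoid.ker (labelHom hab a) p 1 := by
    rw [Setoid.ker_def, ha, map_one]
  rw [e, Setoid.ker_def, hb, map_one] at h1
  exact congrArg Subtype.val h1

theorem frobeniusSquare_injective (hH : IsFrobeniusComplement H)
    (hab : ∀ x y : frobeniusKernel H, x * y = y * x) :
    Function.Injective (frobeniusSquare H) := by
  intro h k e
  have : cellPartition (frobeniusSquare H) (.letter h) =
      cellPartition (frobeniusSquare H) (.letter k) := by
    simp only [cellPartition, e]
  exact PartLabel.letter.inj (cellPartition_frobeniusSquare_injective hH hab this)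

theorem exists_isGrid_frobeniusSquare (hH : IsFrobeniusComplement H)
    (hab : ∀ x y : frobeniusKernel H, x * y = y * x) {a b c : PartLabel H}
    (hab' : a ≠ b) (hac : a ≠ c) (hbc : b ≠ c) :
    ∃ h : IsGrid (cellPartition (frobeniusSquare H) a) (cellPartition (frobeniusSquare H) b),
      IsLatinSquare (Nat.card (frobeniusKernel H))
        (tripleSquare _ _ (cellPartition (frobeniusSquare H) c) h) ∧
      Isotopic (tripleSquare _ _ (cellPartition (frobeniusSquare H) c) h)
        (cayleyTable (frobeniusKernel H)) := by
  rw [cellPartition_frobeniusSquare hab a, cellPartition_frobeniusSquare hab b,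
    cellPartition_frobeniusSquare hab c]
  have hiso := isotopic_tripleSquare_ker (bijective_labelHom_prod hH hab hab')
    (bijective_labelHom_prod hH hab hac).1 (bijective_labelHom_prod hH hab hbc)
    (isGrid_ker (bijective_labelHom_prod hH hab hab'))
  exact ⟨_, .of_isotopic_cayleyTable hiso, hiso⟩

theorem isMOLS_frobeniusSquare (hH : IsFrobeniusComplement H)
    (hab : ∀ x y : frobeniusKernel H, x * y = y * x) :
    IsMOLS (Nat.card (frobeniusKernel H)) (frobeniusSquare H) where
  -- Relabelling columns by the automorphism `y ↦ y^h` turns `L_h` into the Cayley table.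
  latin h := .of_isotopic_cayleyTable
    ⟨Equiv.refl _, (MulAut.conjNormal (h : G)⁻¹).toEquiv, Equiv.refl _, fun _ _ => rfl⟩
  orthogonal _ _ hij :=
    bijective_labelHom_prod hH hab fun e => hij (PartLabel.letter.inj e)

end Frobenius

theorem mainTheorem3 {G : Type*} [Group G] [Finite G] (H : Subgroup G)
    (hH : IsFrobeniusComplement H)
    (hab : ∀ x y : frobeniusKernel H, x * y = y * x) :
    -- the squares `L_h` are mutually orthogonal Latin (indeed group) squares of order `|N|`
    IsMOLS (Nat.card (frobeniusKernel H)) (frobeniusSquare H) ∧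
    IsMOGS (Nat.card (frobeniusKernel H)) (frobeniusSquare H) ∧
    -- there are `|H|` squares, `|H| + 2` partitions, and `(|H| + 2).choose 3` triples of them
    (Set.range (frobeniusSquare H)).ncard = Nat.card H ∧
    (Set.range (cellPartition (frobeniusSquare H))).ncard = Nat.card H + 2 ∧
    {T : Set (Setoid (frobeniusKernel H × frobeniusKernel H)) |
      T ⊆ Set.range (cellPartition (frobeniusSquare H)) ∧ T.ncard = 3}.ncard =
        (Nat.card H + 2).choose 3 ∧
    -- every triple, in every order, defines a Latin square isotopic to the Cayley table of `N`
    ∀ P ∈ Set.range (cellPartition (frobeniusSquare H)),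
    ∀ Q ∈ Set.range (cellPartition (frobeniusSquare H)),
    ∀ T ∈ Set.range (cellPartition (frobeniusSquare H)),
      P ≠ Q → P ≠ T → Q ≠ T →
      ∃ h : IsGrid P Q,
        IsLatinSquare (Nat.card (frobeniusKernel H)) (tripleSquare P Q T h) ∧
        Isotopic (tripleSquare P Q T h) (cayleyTable (frobeniusKernel H)) := by
  have : Finite (PartLabel H) := Finite.of_equiv _ (partLabelEquiv H).symm
  have hcard : (Set.range (cellPartition (frobeniusSquare H))).ncard = Nat.card H + 2 :=
    (Nat.card_range_of_injective (cellPartition_frobeniusSquare_injective hH hab)).trans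
      (card_partLabel H)
  refine ⟨isMOLS_frobeniusSquare hH hab, ⟨isMOLS_frobeniusSquare hH hab, fun a b c h1 h2 h3 => ?_⟩,
    ?_, ?_, ?_, ?_⟩
  · obtain ⟨h, hL, hI⟩ := exists_isGrid_frobeniusSquare hH hab h1 h2 h3
    exact ⟨h, hL, _, _, hI⟩
  · exact Nat.card_range_of_injective (frobeniusSquare_injective hH hab)
  · exact hcard
  · rw [← hcard]
    exact (Set.finite_range _).ncard_subsets_ncard_eq 3
  · rintro _ ⟨a, rfl⟩ _ ⟨b, rfl⟩ _ ⟨c, rfl⟩ h1 h2 h3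
    exact exists_isGrid_frobeniusSquare hH hab (ne_of_apply_ne _ h1) (ne_of_apply_ne _ h2)
      (ne_of_apply_ne _ h3)
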